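/- Let $E$ be a Riesz space (a real vector lattice), let $F$ be a real Banach space with a partial order that makes it an ordered vector space whose positive cone $\{y\in F : y\ge 0\}$ is norm closed (for example, any Banach lattice), and let $n\ge 1$. Let $A:E^n\to F$ be a symmetric $n$-linear map that is positive, i.e. $A(x_1,\dots,x_n)\ge 0$ whenever $x_1,\dots,x_n\ge 0$, and let $\hat A(x)=A(x,\dots,x)$ be the associated $n$-homogeneous polynomial. Call $x,y\in E$ disjoint if $|x|\wedge|y|=0$. Then $A$ is orthosymmetric, i.e. $A(x_1,\dots,x_n)=0$ for all $x_1,\dots,x_n\in E$ such that $x_i$ and $x_j$ are disjoint for some $i\neq j$, if and only if $\hat A$ is orthogonally additive, i.e. $\hat A(x+y)=\hat A(x)+\hat A(y)$ for all disjoint $x,y\in E$. -/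

import Mathlib

namespace RieszPoly

/-- Two elements of a Riesz space are disjoint if the infimum of their absolute values is zero. -/
def AbsDisjoint {E : Type*} [Lattice E] [AddCommGroup E] (x y : E) : Prop :=
  |x| ⊓ |y| = 0

/-- A function on a Riesz space is orthogonally additive if it is additive on pairs of disjoint
elements. -/
def OrthogonallyAdditive {E F : Type*} [Lattice E] [AddCommGroup E] [Add F] (P : E → F) : Prop :=
  ∀ x y : E, AbsDisjoint x y → P (x + y) = P x + P y

section Multilinear

variable {n : ℕ} {E F : Type*} [AddCommGroup E] [Module ℝ E] [AddCommGroup F] [Module ℝ F]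

/-- The `n`-homogeneous polynomial `x ↦ A (x, …, x)` associated with an `n`-linear map `A`. -/
def hat (A : MultilinearMap ℝ (fun _ : Fin n => E) F) (x : E) : F :=
  A (fun _ => x)

/-- `A` is symmetric if its value does not change when its arguments are permuted. -/
def IsSymmetric (A : MultilinearMap ℝ (fun _ : Fin n => E) F) : Prop :=
  ∀ (σ : Equiv.Perm (Fin n)) (x : Fin n → E), A (fun i => x (σ i)) = A x

/-- `A` is positive if it takes tuples of positive elements to positive elements. -/
def IsPositive [Lattice E] [PartialOrder F] (A : MultilinearMap ℝ (fun _ : Fin n => E) F) : Prop :=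
  ∀ x : Fin n → E, (∀ i, 0 ≤ x i) → 0 ≤ A x

/-- `A` is orthosymmetric if it vanishes on every tuple that has two disjoint entries (at two
different places; an entry that is disjoint from itself is zero, so `A` vanishes there anyway). -/
def IsOrthosymmetric [Lattice E] (A : MultilinearMap ℝ (fun _ : Fin n => E) F) : Prop :=
  ∀ x : Fin n → E, (∃ i j : Fin n, i ≠ j ∧ AbsDisjoint (x i) (x j)) → A x = 0

end Multilinear

end RieszPoly

namespace RieszPoly

/-! ### Disjointness in lattice-ordered groups. -/

section Lattice

variable {E : Type*} [AddCommGroup E] [Lattice E] [IsOrderedAddMonoid E]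

/-! Expand `hat A (x + y)`: orthosymmetry kills the mixed terms. Conversely, for disjoint `x, y ≥ 0`
the mixed terms are nonnegative with sum zero, so each vanishes; by monotonicity `A w = 0` once the
indices split into two mutually disjoint families. `map_eq_zero_of_disjoint_families` assigns the
remaining indices one at a time, by splitting an entry and truncating others up to an error that
tends to zero. Signs are handled by positive and negative parts. -/

theorem inf_add_posPart_sub (a b : E) : a ⊓ b + (a - b)⁺ = a := by
  rw [posPart_def, ← sub_self a, ← sub_inf, inf_comm b a, add_sub_cancel]

theorem add_inf_eq_zero {a b c : E} (ha : 0 ≤ a) (hb : 0 ≤ b) (hc : 0 ≤ c)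
    (hac : a ⊓ c = 0) (hbc : b ⊓ c = 0) : (a + b) ⊓ c = 0 := by
  refine le_antisymm ?_ (le_inf (add_nonneg ha hb) hc)
  have h : (a + b) ⊓ c - b ≤ a ⊓ c :=
    le_inf (sub_le_iff_le_add.2 inf_le_left) ((sub_le_self _ hb).trans inf_le_right)
  rw [hac, sub_nonpos] at h
  exact (le_inf h inf_le_right).trans hbc.le

theorem sum_inf_eq_zero {ι : Type*} {S : Finset ι} {w : ι → E} {c : E} (hc : 0 ≤ c)
    (hw : ∀ i, 0 ≤ w i) (h : ∀ i ∈ S, w i ⊓ c = 0) : (∑ i ∈ S, w i) ⊓ c = 0 := by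
  classical
  induction S using Finset.induction_on with
  | empty => simpa using hc
  | insert a S ha ih =>
    rw [Finset.sum_insert ha]
    exact add_inf_eq_zero (hw a) (Finset.sum_nonneg fun i _ => hw i) hc
      (h a (Finset.mem_insert_self _ _)) (ih fun i hi => h i (Finset.mem_insert_of_mem hi))

end Lattice

theorem inf_eq_zero_of_le {E : Type*} [AddCommGroup E] [Lattice E] {a b c d : E}
    (ha : 0 ≤ a) (hb : 0 ≤ b) (hac : a ≤ c) (hbd : b ≤ d) (h : c ⊓ d = 0) : a ⊓ b = 0 :=
  le_antisymm ((inf_le_inf hac hbd).trans h.le) (le_inf ha hb)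

/-! ### Expansion of the polynomial and positivity. -/

section Expansion

variable {n : ℕ} {E F : Type*} [AddCommGroup E] [Module ℝ E] [AddCommGroup F] [Module ℝ F]

theorem hat_add (hn : 1 ≤ n) (A : MultilinearMap ℝ (fun _ : Fin n => E) F) (x y : E) :
    hat A (x + y) = hat A x + hat A y +
      ∑ s ∈ (Finset.univ.erase (Finset.univ : Finset (Fin n))).erase ∅,
        A (s.piecewise (fun _ => x) (fun _ => y)) := by
  have hne : (∅ : Finset (Fin n)) ≠ Finset.univ := fun h => by
    have h0 := Finset.mem_univ (⟨0, hn⟩ : Fin n)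
    simp [← h] at h0
  have h := A.map_add_univ (fun _ => x) (fun _ => y)
  rw [← Finset.add_sum_erase _ _ (Finset.mem_univ (Finset.univ : Finset (Fin n))),
    ← Finset.add_sum_erase _ _ (Finset.mem_erase.2 ⟨hne, Finset.mem_univ _⟩),
    Finset.piecewise_univ, Finset.piecewise_empty, ← add_assoc] at h
  exact h

end Expansion

theorem IsPositive.piecewise_nonneg {n : ℕ} {E F : Type*} [AddCommGroup E] [Lattice E] [Module ℝ E]
    [AddCommGroup F] [Module ℝ F] [PartialOrder F] {A : MultilinearMap ℝ (fun _ : Fin n => E) F}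
    (hpos : IsPositive A) {v w : Fin n → E} (hv : ∀ i, 0 ≤ v i) (hw : ∀ i, 0 ≤ w i)
    (s : Finset (Fin n)) : 0 ≤ A (s.piecewise v w) :=
  hpos _ fun i => by
    by_cases hi : i ∈ s
    · simpa [hi] using hv i
    · simpa [hi] using hw i

section Positive

variable {n : ℕ} {E F : Type*} [AddCommGroup E] [Lattice E] [IsOrderedAddMonoid E] [Module ℝ E]
  [AddCommGroup F] [Module ℝ F] [PartialOrder F] [IsOrderedAddMonoid F]
  {A : MultilinearMap ℝ (fun _ : Fin n => E) F}

theorem IsPositive.map_mono (hpos : IsPositive A) {v w : Fin n → E} (hv : ∀ i, 0 ≤ v i)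
    (hvw : ∀ i, v i ≤ w i) : A v ≤ A w := by
  have h := A.map_add_univ v (w - v)
  rw [add_sub_cancel] at h
  rw [h]
  simpa using Finset.single_le_sum
    (f := fun s : Finset (Fin n) => A (s.piecewise v (w - v)))
    (fun s _ => hpos.piecewise_nonneg hv (fun i => sub_nonneg.2 (hvw i)) s)
    (Finset.mem_univ Finset.univ)

theorem map_piecewise_eq_zero (hn : 1 ≤ n) (hpos : IsPositive A)
    (hadd : OrthogonallyAdditive (hat A)) {x y : E} (hx : 0 ≤ x) (hy : 0 ≤ y) (hxy : x ⊓ y = 0)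
    {s : Finset (Fin n)} (hs : s ≠ ∅) (hs' : s ≠ Finset.univ) :
    A (s.piecewise (fun _ => x) (fun _ => y)) = 0 := by
  have h := hadd x y (by rw [AbsDisjoint, abs_of_nonneg hx, abs_of_nonneg hy, hxy])
  rw [hat_add hn, add_eq_left, Finset.sum_eq_zero_iff_of_nonneg
    fun s _ => hpos.piecewise_nonneg (fun _ => hx) (fun _ => hy) s] at h
  exact h s (by simp [hs, hs'])

/-- Each entry is dominated by the sum over its own family, and the two sums are disjoint. -/
theorem map_eq_zero_of_partition (hn : 1 ≤ n) (hpos : IsPositive A)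
    (hadd : OrthogonallyAdditive (hat A)) {w : Fin n → E} (hw : ∀ i, 0 ≤ w i)
    {S T : Finset (Fin n)} (hS : S.Nonempty) (hT : T.Nonempty) (hST : Disjoint S T)
    (hU : ∀ i, i ∈ S ∨ i ∈ T) (h : ∀ i ∈ S, ∀ j ∈ T, w i ⊓ w j = 0) : A w = 0 := by
  refine le_antisymm ?_ (hpos w hw)
  have hx : 0 ≤ ∑ i ∈ S, w i := Finset.sum_nonneg fun i _ => hw i
  have hy : 0 ≤ ∑ i ∈ T, w i := Finset.sum_nonneg fun i _ => hw i
  have hxy : (∑ i ∈ S, w i) ⊓ ∑ i ∈ T, w i = 0 :=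
    sum_inf_eq_zero hy hw fun i hi => by
      rw [inf_comm]
      exact sum_inf_eq_zero (hw i) hw fun j hj => by rw [inf_comm, h i hi j hj]
  have hSu : S ≠ Finset.univ := by
    rintro rfl
    obtain ⟨j, hj⟩ := hT
    exact Finset.disjoint_left.1 hST (Finset.mem_univ j) hj
  rw [← map_piecewise_eq_zero hn hpos hadd hx hy hxy hS.ne_empty hSu]
  refine hpos.map_mono hw fun i => ?_
  by_cases hi : i ∈ S
  · simpa [hi] using Finset.single_le_sum (fun i _ => hw i) hi
  · simpa [hi] using Finset.single_le_sum (fun i _ => hw i) ((hU i).resolve_left hi)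

end Positive

section Approximation

variable {n : ℕ} {E F : Type*} [AddCommGroup E] [Lattice E] [IsOrderedAddMonoid E]
  [Module ℝ E] [IsOrderedModule ℝ E]
  [AddCommGroup F] [Module ℝ F] [PartialOrder F] [IsOrderedAddMonoid F] [IsOrderedModule ℝ F]
  {A : MultilinearMap ℝ (fun _ : Fin n => E) F}

/-- A small perturbation of a zero of a positive multilinear map has a small value. -/
theorem IsPositive.map_le_smul (hpos : IsPositive A) {v w : Fin n → E} {u : E} {ε : ℝ}
    (hε : 0 ≤ ε) (hε1 : ε ≤ 1) (hv : ∀ i, 0 ≤ v i) (hvu : ∀ i, v i ≤ u) (hw : ∀ i, 0 ≤ w i)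
    (hwv : ∀ i, w i ≤ v i + ε • u) (hu : 0 ≤ u) (hAv : A v = 0) :
    A w ≤ ε • ((2 : ℝ) ^ n • hat A u) := by
  have hAu : 0 ≤ hat A u := hpos _ fun _ => hu
  calc A w ≤ A (v + fun _ => ε • u) := hpos.map_mono hw hwv
    _ = ∑ s : Finset (Fin n), A (s.piecewise v fun _ => ε • u) := A.map_add_univ _ _
    _ ≤ ∑ _s : Finset (Fin n), ε • hat A u := by
      refine Finset.sum_le_sum fun s _ => ?_
      by_cases hs : s = Finset.univ
      · rw [hs, Finset.piecewise_univ, hAv]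
        exact smul_nonneg hε hAu
      -- One slot outside `s` supplies the factor `ε`; every other entry is at most `u`, as `ε ≤ 1`.
      · obtain ⟨k, hk⟩ : ∃ k, k ∉ s := by
          by_contra! hc
          exact hs (Finset.eq_univ_of_forall hc)
        have hεu : ε • u ≤ u := by
          simpa using smul_le_smul_of_nonneg_right hε1 hu
        have hup : A (Function.update (fun _ => u) k (ε • u)) = ε • hat A u := by
          rw [A.map_update_smul, Function.update_eq_self]
          rfl
        rw [← hup]
        refine hpos.map_mono (fun i => ?_) fun i => ?_
        · by_cases hi : i ∈ s
          · simpa [hi] using hv i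
          · simpa [hi] using smul_nonneg hε hu
        · by_cases hik : i = k
          · subst hik
            simp [hk]
          · by_cases hi : i ∈ s
            · simpa [hi, hik] using hvu i
            · simpa [hi, hik] using hεu
    _ = ε • ((2 : ℝ) ^ n • hat A u) := by
      rw [Finset.sum_const, Finset.card_univ, Fintype.card_finset, Fintype.card_fin,
        ← Nat.cast_smul_eq_nsmul ℝ, smul_comm]
      norm_num

end Approximation

/-! ### From two disjoint entries to a vanishing value. -/

section Main

variable {n : ℕ} {E F : Type*} [AddCommGroup E] [Lattice E] [IsOrderedAddMonoid E]
  [Module ℝ E] [IsOrderedModule ℝ E]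
  [NormedAddCommGroup F] [NormedSpace ℝ F] [PartialOrder F] [IsOrderedAddMonoid F]
  [IsOrderedModule ℝ F] [OrderClosedTopology F]
  {A : MultilinearMap ℝ (fun _ : Fin n => E) F}

theorem map_eq_zero_of_disjoint_families (hn : 1 ≤ n) (hpos : IsPositive A)
    (hadd : OrthogonallyAdditive (hat A)) (m : ℕ) :
    ∀ {w : Fin n → E} {S T : Finset (Fin n)}, (∀ i, 0 ≤ w i) → S.Nonempty → T.Nonempty →
      Disjoint S T → (S ∪ T)ᶜ.card = m → (∀ i ∈ S, ∀ j ∈ T, w i ⊓ w j = 0) → A w = 0 := by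
  induction m with
  | zero =>
    intro w S T hw hS hT hST hm h
    refine map_eq_zero_of_partition hn hpos hadd hw hS hT hST (fun i => ?_) h
    have hi : i ∉ (S ∪ T)ᶜ := by simp [Finset.card_eq_zero.1 hm]
    simpa [or_iff_not_imp_left] using hi
  | succ m ih =>
    intro w S T hw hS hT hST hm h
    obtain ⟨k, hk⟩ : (S ∪ T)ᶜ.Nonempty := Finset.card_pos.1 (by omega)
    have hkST : k ∉ S ∧ k ∉ T := by simpa using hk
    obtain ⟨hkS, hkT⟩ := hkST
    set u := ∑ i, w i
    have hu : 0 ≤ u := Finset.sum_nonneg fun i _ => hw i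
    have hwu : ∀ i, w i ≤ u := fun i =>
      Finset.single_le_sum (fun i _ => hw i) (Finset.mem_univ i)
    set x := ∑ i ∈ S, w i
    have hx : 0 ≤ x := Finset.sum_nonneg fun i _ => hw i
    have hwx : ∀ i ∈ S, w i ≤ x := fun i hi => Finset.single_le_sum (fun i _ => hw i) hi
    have hxT : ∀ j ∈ T, x ⊓ w j = 0 := fun j hj =>
      sum_inf_eq_zero (hw j) hw fun i hi => h i hi j hj
    have key : ∀ ε : ℝ, 0 < ε → ε ≤ 1 → A w ≤ ε • ((2 : ℝ) ^ n • hat A u) := by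
      intro ε hε hε1
      -- Scaling entry `k` keeps the truncation by `z` within `ε • u`; homogeneity removes the
      -- factor at the end.
      set z := ε • w k with hz_def
      have hz : 0 ≤ z := smul_nonneg hε.le (hw k)
      have hzu : z ≤ ε • u := smul_le_smul_of_nonneg_left (hwu k) hε.le
      set v : Fin n → E := fun i => if i ∈ S then (w i - z)⁺ else w i
      have hvS : ∀ i ∈ S, v i = (w i - z)⁺ := fun i hi => if_pos hi
      have hvn : ∀ i ∉ S, v i = w i := fun i hi => if_neg hi
      have hv : ∀ i, 0 ≤ v i := fun i => by
        by_cases hi : i ∈ S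
        · rw [hvS i hi]; exact posPart_nonneg _
        · rw [hvn i hi]; exact hw i
      have hvw : ∀ i, v i ≤ w i := fun i => by
        by_cases hi : i ∈ S
        · rw [hvS i hi, posPart_def]; exact sup_le (sub_le_self _ hz) (hw i)
        · rw [hvn i hi]
      refine hpos.map_le_smul hε.le hε1 hv (fun i => (hvw i).trans (hwu i)) hw (fun i => ?_) hu ?_
      · by_cases hi : i ∈ S
        · rw [hvS i hi, ← sub_le_iff_le_add]
          exact (sub_le_sub_left hzu _).trans (le_posPart _)
        · rw [hvn i hi]
          exact le_add_of_nonneg_right (smul_nonneg hε.le hu)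
      · have hcard : ∀ S' T' : Finset (Fin n), S' ∪ T' = insert k (S ∪ T) →
            (S' ∪ T')ᶜ.card = m := by
          intro S' T' h'
          rw [h', Finset.compl_insert, Finset.card_erase_of_mem hk, hm, Nat.add_sub_cancel]
        have hupd : ∀ {c : E}, 0 ≤ c → ∀ i, 0 ≤ Function.update v k c i := by
          intro c hc i
          by_cases hik : i = k
          · subst hik; simpa using hc
          · simpa [hik] using hv i
        have hSk : ∀ i ∈ S, i ≠ k := fun i hi e => hkS (e ▸ hi)
        have hTk : ∀ i ∈ T, i ≠ k := fun i hi e => hkT (e ▸ hi)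
        have hvST : ∀ i ∈ S, ∀ j ∈ T, v i ⊓ v j = 0 := fun i hi j hj =>
          inf_eq_zero_of_le (hv i) (hv j) (hvw i) (hvw j) (h i hi j hj)
        -- `z = z ⊓ x + (z - x)⁺`. The first piece lies below `x`, hence is disjoint from the `T`
        -- entries, so `k` can join `S`.
        have hleft : A (Function.update v k (z ⊓ x)) = 0 := by
          refine ih (S := insert k S) (T := T) (hupd (le_inf hz hx)) (Finset.insert_nonempty _ _)
            hT (Finset.disjoint_insert_left.2 ⟨hkT, hST⟩)
            (hcard _ _ (Finset.insert_union _ _ _)) ?_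
          intro i hi j hj
          rw [Function.update_of_ne (hTk j hj)]
          rcases Finset.mem_insert.1 hi with rfl | hi
          · rw [Function.update_self]
            exact inf_eq_zero_of_le (le_inf hz hx) (hv j) inf_le_right (hvw j) (hxT j hj)
          · rw [Function.update_of_ne (hSk i hi)]
            exact hvST i hi j hj
        -- The second piece is disjoint from the truncated entries `(w i - z)⁺ ≤ (x - z)⁺`, so `k`
        -- can join `T`.
        have hright : A (Function.update v k (z - x)⁺) = 0 := by
          refine ih (S := S) (T := insert k T) (hupd (posPart_nonneg _)) hS
            (Finset.insert_nonempty _ _) (Finset.disjoint_insert_right.2 ⟨hkS, hST⟩)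
            (hcard _ _ (Finset.union_insert _ _ _)) ?_
          intro i hi j hj
          rw [Function.update_of_ne (hSk i hi)]
          rcases Finset.mem_insert.1 hj with rfl | hj
          · rw [Function.update_self, hvS i hi]
            refine inf_eq_zero_of_le (posPart_nonneg _) (posPart_nonneg _)
              (posPart_mono (sub_le_sub_right (hwx i hi) z)) le_rfl ?_
            rw [← neg_sub x z, posPart_neg]
            exact posPart_inf_negPart_eq_zero _
          · rw [Function.update_of_ne (hTk j hj)]
            exact hvST i hi j hj
        have hsum : A (Function.update v k z) = 0 := by
          rw [← inf_add_posPart_sub z x, A.map_update_add, hleft, hright, add_zero]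
        rw [hz_def, A.map_update_smul, ← hvn k hkS, Function.update_eq_self] at hsum
        exact (smul_eq_zero.1 hsum).resolve_left hε.ne'
    refine le_antisymm ?_ (hpos w hw)
    have hlim : Filter.Tendsto (fun ε : ℝ => ε • ((2 : ℝ) ^ n • hat A u))
        (nhdsWithin 0 (Set.Ioi 0)) (nhds 0) := by
      have hc : Continuous fun ε : ℝ => ε • ((2 : ℝ) ^ n • hat A u) := by fun_prop
      simpa using (hc.tendsto 0).mono_left nhdsWithin_le_nhds
    -- Closedness of the cone of `F` lets the bound pass to the limit `ε → 0`.
    refine ge_of_tendsto hlim ?_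
    filter_upwards [Ioo_mem_nhdsGT (zero_lt_one' ℝ)] with ε hε
    exact key ε hε.1 hε.2.le

theorem isOrthosymmetric_of_orthogonallyAdditive (hn : 1 ≤ n) (hpos : IsPositive A)
    (hadd : OrthogonallyAdditive (hat A)) : IsOrthosymmetric A := by
  rintro x ⟨i, j, hij, hdis⟩
  have hx : x = (fun i => (x i)⁺) + fun i => (-1 : ℝ) • (x i)⁻ := by
    ext i
    simp [← sub_eq_add_neg]
  rw [hx, A.map_add_univ]
  refine Finset.sum_eq_zero fun s _ => ?_
  set w : Fin n → E := s.piecewise (fun i => (x i)⁺) fun i => (x i)⁻ with hw_def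
  have hsign : (s.piecewise (fun i => (x i)⁺) fun i => (-1 : ℝ) • (x i)⁻) =
      fun i => (if i ∈ s then 1 else -1 : ℝ) • w i := by
    ext i
    by_cases hi : i ∈ s <;> simp [hw_def, hi]
  have hw : ∀ i, 0 ≤ w i := fun i => by
    by_cases hi : i ∈ s <;> simp [hw_def, hi, posPart_nonneg, negPart_nonneg]
  have hwx : ∀ i, w i ≤ |x i| := fun i => by
    by_cases hi : i ∈ s
    · simpa [hw_def, hi, posPart_def] using le_abs_self (x i)
    · simpa [hw_def, hi, negPart_def] using neg_le_abs (x i)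
  have h0 : A w = 0 := by
    refine map_eq_zero_of_disjoint_families hn hpos hadd _ (S := {i}) (T := {j}) hw
      (Finset.singleton_nonempty i) (Finset.singleton_nonempty j)
      (Finset.disjoint_singleton.2 hij) rfl ?_
    simp only [Finset.mem_singleton]
    rintro _ rfl _ rfl
    exact inf_eq_zero_of_le (hw _) (hw _) (hwx _) (hwx _) hdis
  rw [hsign, A.map_smul_univ, h0, smul_zero]

end Main

theorem IsOrthosymmetric.orthogonallyAdditive {n : ℕ} {E F : Type*} [AddCommGroup E] [Lattice E]
    [Module ℝ E] [AddCommGroup F] [Module ℝ F] {A : MultilinearMap ℝ (fun _ : Fin n => E) F}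
    (hn : 1 ≤ n) (hA : IsOrthosymmetric A) : OrthogonallyAdditive (hat A) := by
  intro x y hxy
  rw [hat_add hn, Finset.sum_eq_zero, add_zero]
  intro s hs
  obtain ⟨hs0, hs1⟩ : s ≠ ∅ ∧ s ≠ Finset.univ := by simpa using hs
  obtain ⟨i, hi⟩ := Finset.nonempty_iff_ne_empty.2 hs0
  obtain ⟨j, hj⟩ : ∃ j, j ∉ s := by
    by_contra! hc
    exact hs1 (Finset.eq_univ_of_forall hc)
  refine hA _ ⟨i, j, fun e => hj (e ▸ hi), ?_⟩
  simpa [hi, hj] using hxy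

end RieszPoly

theorem mainTheorem5
    {E : Type*} [AddCommGroup E] [Lattice E] [IsOrderedAddMonoid E]
    [Module ℝ E] [IsOrderedModule ℝ E]
    {F : Type*} [NormedAddCommGroup F] [NormedSpace ℝ F] [CompleteSpace F]
    [PartialOrder F] [IsOrderedAddMonoid F] [IsOrderedModule ℝ F] [OrderClosedTopology F]
    (n : ℕ) (hn : 1 ≤ n)
    (A : MultilinearMap ℝ (fun _ : Fin n => E) F)
    (hsymm : RieszPoly.IsSymmetric A) (hpos : RieszPoly.IsPositive A) :
    RieszPoly.IsOrthosymmetric A ↔ RieszPoly.OrthogonallyAdditive (RieszPoly.hat A) :=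
  ⟨fun h => h.orthogonallyAdditive hn,
    fun h => RieszPoly.isOrthosymmetric_of_orthogonallyAdditive hn hpos h⟩
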